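/- Let $H$ be a separable complex Hilbert space, of finite or infinite dimension, let $\mathcal T(H)$ be the space of trace class operators and $\mathcal S(H)$ the set of states (positive trace class operators of trace $1$). An observable $A$ on $H$ is a map $x\mapsto A(x)$ from a finite set $\Omega_A$ to the positive bounded operators on $H$ with $\sum_x A(x)=I$; let $\mathcal O(H)$ be the set of observables with $\Omega_A\subset\mathbb Z$. An observable $A$ is informationally complete if $\varrho=\sigma$ whenever $\varrho,\sigma\in\mathcal S(H)$ satisfy $\operatorname{tr}[\varrho A(x)]=\operatorname{tr}[\sigma A(x)]$ for all $x$. A channel is a completely positive linear map between spaces of trace class operators that maps states to states. Two observables $A,B$ are * compatible if there is an observable $J$ on $\Omega_A\times\Omega_B$ with $\sum_y J(x,y)=A(x)$ and $\sum_x J(x,y)=B(y)$ for all $x,y$; * broadcastable if there is a channel $\Lambda:\mathcal T(H)\to\mathcal T(H\otimes H)$ such that, for all states $\varrho$ and both $C=A$ and $C=B$, $\operatorname{tr}[\varrho C(x)]=\operatorname{tr}[\Lambda(\varrho)\,C(x)\otimes I]=\operatorname{tr}[\Lambda(\varrho)\,I\otimes C(x)]$ for all $x\in\Omega_C$; * one-side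 broadcastable if there is a channel $\Lambda:\mathcal T(H)\to\mathcal T(H\otimes H)$ such that $\operatorname{tr}[\varrho A(x)]=\operatorname{tr}[\Lambda(\varrho)\,A(x)\otimes I]$ and $\operatorname{tr}[\varrho B(y)]=\operatorname{tr}[\Lambda(\varrho)\,I\otimes B(y)]$ for all states $\varrho$ and all $x,y$. $A$ can be measured without disturbing $B$ if there are completely positive linear maps $\mathcal I_x:\mathcal T(H)\to\mathcal T(H)$, $x\in\Omega_A$, with $\operatorname{tr}[\mathcal I_x(\varrho)]=\operatorname{tr}[\varrho A(x)]$ and $\operatorname{tr}[\sum_x\mathcal I_x(\varrho)\,B(y)]=\operatorname{tr}[\varrho B(y)]$ for all states $\varrho$ and all $x,y$. $A$ and $B$ are mutually nondisturbing (nondisturbing) if $A$ can be measured without disturbing $B$ and (or) $B$ can be measured without disturbing $A$. Then: 1. Every observable is compatible with itself; in particular compatibility is a reflexive relation on $\mathcal O(H)$. 2. If $\dim H\ge 2$, an informationally complete observable $A$ cannot be measured without disturbing itself, and the pair $(A,A)$ is not nondisturbing, not mutually nondisturbing, not one-side broadcastable and not broadcastable. 3. If $\dim H<\infty$, then $\mathcal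 O(H)$ contains an informationally complete observable. 4. If $\dim H\ge 2$, none of the four relations nondisturbance, mutual nondisturbance, one-side broadcastability and broadcastability is reflexive on $\mathcal O(H)$. 5. Let $A$ be informationally complete, $0<\lambda\le 1$ and $t$ a probability distribution on $\Omega_A$. Then $\widetilde A(x)=\lambda A(x)+(1-\lambda)t(x)I$ is informationally complete, and hence, if $\dim H\ge 2$, cannot be measured without disturbing itself. -/

import Mathlib

open scoped ComplexOrder TensorProduct InnerProductSpace

noncomputable section

set_option linter.unusedSectionVars false

namespace QObs

/-! ### Trace class operators and states -/

/-- The elements of an orthonormal basis of `H`, fixed once and for all. -/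
def basisSet (H : Type*) [NormedAddCommGroup H] [InnerProductSpace ℂ H] [CompleteSpace H] :
    Set H :=
  (exists_hilbertBasis ℂ H).choose

/-- An orthonormal basis of `H`, fixed once and for all. -/
def basis (H : Type*) [NormedAddCommGroup H] [InnerProductSpace ℂ H] [CompleteSpace H] :
    HilbertBasis (basisSet H) ℂ H :=
  (exists_hilbertBasis ℂ H).choose_spec.choose

variable {H K : Type*}
  [NormedAddCommGroup H] [InnerProductSpace ℂ H] [CompleteSpace H]
  [NormedAddCommGroup K] [InnerProductSpace ℂ K] [CompleteSpace K]

/-- The trace `∑ᵢ ⟨eᵢ, T eᵢ⟩`. For the operators to which it is applied below (trace class ones) the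
series converges absolutely, with a sum that does not depend on the orthonormal basis; for positive
operators see `hasSum_trace_indep`. -/
def opTrace (T : H →L[ℂ] H) : ℂ :=
  ∑' i, ⟪basis H i, T (basis H i)⟫_ℂ

/-- For a positive operator `T`, this says that `∑ᵢ ⟨eᵢ, T eᵢ⟩ < ∞`. -/
def HasFiniteTrace (T : H →L[ℂ] H) : Prop :=
  Summable fun i => ⟪basis H i, T (basis H i)⟫_ℂ

theorem tsum_sq_inner {ι : Type*} (e : HilbertBasis ι ℂ H) (x : H) :
    ∑' i, ENNReal.ofReal (‖⟪e i, x⟫_ℂ‖ ^ 2) = ENNReal.ofReal (‖x‖ ^ 2) := by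
  have h1 : HasSum (fun i => ‖⟪e i, x⟫_ℂ‖ ^ 2) (‖x‖ ^ 2) := by
    have h2 := e.hasSum_inner_mul_inner x x
    rw [inner_self_eq_norm_sq_to_K] at h2
    have h3 := Complex.hasSum_re h2
    convert! h3 using 1
    · ext i
      rw [← inner_conj_symm x (e i), RCLike.conj_mul]
      norm_cast
    · norm_cast
  rw [← ENNReal.ofReal_tsum_of_nonneg (fun _ => by positivity) h1.summable, h1.tsum_eq]

theorem tsum_sq_norm_adjoint {ι κ : Type*} (e : HilbertBasis ι ℂ H) (f : HilbertBasis κ ℂ H)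
    (S : H →L[ℂ] H) :
    ∑' i, ENNReal.ofReal (‖S (e i)‖ ^ 2) =
      ∑' j, ENNReal.ofReal (‖ContinuousLinearMap.adjoint S (f j)‖ ^ 2) := by
  simp_rw [← tsum_sq_inner f (S _), ← tsum_sq_inner e (ContinuousLinearMap.adjoint S _)]
  rw [ENNReal.tsum_comm]
  refine tsum_congr fun j => tsum_congr fun i => ?_
  rw [ContinuousLinearMap.adjoint_inner_right, norm_inner_symm]

/-- The trace of a positive operator does not depend on the orthonormal basis. -/
theorem hasSum_trace_indep {ι κ : Type*} (e : HilbertBasis ι ℂ H) (f : HilbertBasis κ ℂ H)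
    {T : H →L[ℂ] H} (hT : T.IsPositive) {c : ℂ}
    (h : HasSum (fun i => ⟪e i, T (e i)⟫_ℂ) c) : HasSum (fun j => ⟪f j, T (f j)⟫_ℂ) c := by
  obtain ⟨S, hS⟩ : ∃ S : H →L[ℂ] H, T = star S * S :=
    CStarAlgebra.nonneg_iff_eq_star_mul_self.mp
      ((ContinuousLinearMap.nonneg_iff_isPositive T).mpr hT)
  have key : ∀ x, ⟪x, T x⟫_ℂ = ((‖S x‖ ^ 2 : ℝ) : ℂ) := by
    intro x
    rw [hS, mul_apply_eq_comp, ContinuousLinearMap.star_eq_adjoint,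
      ContinuousLinearMap.adjoint_inner_right, inner_self_eq_norm_sq_to_K]
    norm_cast
  have heq : ∑' i, ENNReal.ofReal (‖S (e i)‖ ^ 2) = ∑' j, ENNReal.ofReal (‖S (f j)‖ ^ 2) :=
    (tsum_sq_norm_adjoint e f S).trans (tsum_sq_norm_adjoint f f S).symm
  simp_rw [key] at h ⊢
  have hr : HasSum (fun i => ‖S (e i)‖ ^ 2) c.re := Complex.hasSum_re h
  have hc : c = (c.re : ℂ) := by
    have := Complex.hasSum_im h
    simp only [Complex.ofReal_im] at this
    exact Complex.ext rfl (by simpa using this.unique hasSum_zero)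
  rw [hc, Complex.hasSum_ofReal]
  have h1 : ∑' j, ENNReal.ofReal (‖S (f j)‖ ^ 2) = ENNReal.ofReal c.re := by
    rw [← heq, ← ENNReal.ofReal_tsum_of_nonneg (fun _ => by positivity) hr.summable, hr.tsum_eq]
  have h2 : Summable fun j => ‖S (f j)‖ ^ 2 := by
    have := ENNReal.summable_toReal (f := fun j => ENNReal.ofReal (‖S (f j)‖ ^ 2))
      (by rw [h1]; exact ENNReal.ofReal_ne_top)
    simpa [ENNReal.toReal_ofReal] using this
  have h3 := h2.hasSum
  rw [← ENNReal.ofReal_tsum_of_nonneg (fun _ => by positivity) h2,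
    ENNReal.ofReal_eq_ofReal_iff (tsum_nonneg fun _ => by positivity)
      (hr.nonneg fun _ => by positivity)] at h1
  rwa [h1] at h3

/-- The space `𝒯(H)` of trace class operators, as the complex linear span of the positive bounded
operators with finite trace (these are exactly the bounded operators `T` with `tr |T| < ∞`). -/
def traceClass (H : Type*) [NormedAddCommGroup H] [InnerProductSpace ℂ H] [CompleteSpace H] :
    Submodule ℂ (H →L[ℂ] H) :=
  Submodule.span ℂ {T | T.IsPositive ∧ HasFiniteTrace T}

/-- States (density operators): positive trace class operators of trace one. -/
def IsState (ϱ : traceClass H) : Prop :=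
  (ϱ : H →L[ℂ] H).IsPositive ∧ opTrace (ϱ : H →L[ℂ] H) = 1

/-! ### Observables -/

/-- An observable (POVM) on `H` with finite set of outcomes `Ω`. -/
structure POVM (Ω : Type*) [Fintype Ω] (H : Type*) [NormedAddCommGroup H] [InnerProductSpace ℂ H]
    [CompleteSpace H] where
  /-- the operator `A(x)` belonging to the outcome `x` -/
  op : Ω → H →L[ℂ] H
  isPositive : ∀ x, (op x).IsPositive
  sum_op : ∑ x, op x = 1

/-- The set `𝒪(H)` of all observables on `H` whose outcome set is a finite set of integers. -/
abbrev Observable (H : Type*) [NormedAddCommGroup H] [InnerProductSpace ℂ H] [CompleteSpace H] :=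
  Σ Ω : Finset ℤ, POVM Ω H

/-- The probability `tr(ϱ A(x))` of the outcome `x` in the state `ϱ`. -/
def POVM.prob {Ω : Type*} [Fintype Ω] (A : POVM Ω H) (ϱ : traceClass H) (x : Ω) : ℂ :=
  opTrace ((ϱ : H →L[ℂ] H) * A.op x)

/-- `A` is informationally complete if its outcome distribution determines the state. -/
def InformationallyComplete {Ω : Type*} [Fintype Ω] (A : POVM Ω H) : Prop :=
  ∀ ϱ σ : traceClass H, IsState ϱ → IsState σ → (∀ x, A.prob ϱ x = A.prob σ x) → ϱ = σ

/-- The trivial observable `x ↦ t(x) I` of a probability distribution `t`. -/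
def POVM.trivial {Ω : Type*} [Fintype Ω] (t : Ω → ℝ) (ht : t ∈ stdSimplex ℝ Ω) : POVM Ω H where
  op x := (t x : ℂ) • 1
  isPositive x := by
    exact ContinuousLinearMap.isPositive_one.smul_of_nonneg (by exact_mod_cast ht.1 x)
  sum_op := by
    rw [← Finset.sum_smul, ← Complex.ofReal_sum, ht.2, Complex.ofReal_one, one_smul]

/-- The mixture `x ↦ c A(x) + (1 - c) B(x)` of two observables, for `0 ≤ c ≤ 1`. -/
def POVM.mix {Ω : Type*} [Fintype Ω] (c : ℝ) (h0 : 0 ≤ c) (h1 : c ≤ 1) (A B : POVM Ω H) :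
    POVM Ω H where
  op x := (c : ℂ) • A.op x + ((1 - c : ℝ) : ℂ) • B.op x
  isPositive x :=
    ((A.isPositive x).smul_of_nonneg (by exact_mod_cast h0)).add
      ((B.isPositive x).smul_of_nonneg (by exact_mod_cast sub_nonneg.mpr h1))
  sum_op := by
    rw [Finset.sum_add_distrib, ← Finset.smul_sum, ← Finset.smul_sum, A.sum_op, B.sum_op,
      ← add_smul, ← Complex.ofReal_add]
    simp

/-! ### Channels -/

/-- Complete positivity of a linear map `Φ : 𝒯(H) → 𝒯(K)`: for every `n`, if the operator matrix
`(Tᵢⱼ)` is a positive operator on `Hⁿ`, then `(Φ(Tᵢⱼ))` is a positive operator on `Kⁿ`. -/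
def IsCompletelyPositive (Φ : traceClass H →ₗ[ℂ] traceClass K) : Prop :=
  ∀ (n : ℕ) (T : Fin n → Fin n → traceClass H),
    (∀ ψ : Fin n → H, 0 ≤ ∑ i, ∑ j, ⟪ψ i, (T i j : H →L[ℂ] H) (ψ j)⟫_ℂ) →
    ∀ ψ : Fin n → K, 0 ≤ ∑ i, ∑ j, ⟪ψ i, (Φ (T i j) : K →L[ℂ] K) (ψ j)⟫_ℂ

/-- A channel is a completely positive linear map that sends states to states. -/
def IsChannel (Λ : traceClass H →ₗ[ℂ] traceClass K) : Prop :=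
  IsCompletelyPositive Λ ∧ ∀ ϱ, IsState ϱ → IsState (Λ ϱ)

/-! ### Composite systems -/

/-- The Hilbert space tensor product: the completion of the algebraic one. -/
abbrev HTensor (H K : Type*) [NormedAddCommGroup H] [InnerProductSpace ℂ H]
    [NormedAddCommGroup K] [InnerProductSpace ℂ K] :=
  UniformSpace.Completion (H ⊗[ℂ] K)

/-- The operator `S ⊗ T` on the Hilbert space tensor product. -/
def tensorOp (S : H →L[ℂ] H) (T : K →L[ℂ] K) : HTensor H K →L[ℂ] HTensor H K :=
  (TensorProduct.mapL S T).completion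

theorem tensorOp_tmul (S : H →L[ℂ] H) (T : K →L[ℂ] K) (x : H) (y : K) :
    tensorOp S T ((x ⊗ₜ[ℂ] y : H ⊗[ℂ] K) : HTensor H K) =
      ((S x ⊗ₜ[ℂ] T y : H ⊗[ℂ] K) : HTensor H K) := by
  simp [tensorOp]

/-! ### The five relations -/

section relations

variable {Ω Ω' : Type*} [Fintype Ω] [Fintype Ω']

/-- `A` and `B` are compatible if they have a joint observable. -/
def Compatible (A : POVM Ω H) (B : POVM Ω' H) : Prop :=
  ∃ J : POVM (Ω × Ω') H,
    (∀ x, ∑ y, J.op (x, y) = A.op x) ∧ (∀ y, ∑ x, J.op (x, y) = B.op y)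

/-- `Λ` broadcasts `A`: `tr(ϱ A(x)) = tr(Λ(ϱ) A(x) ⊗ I) = tr(Λ(ϱ) I ⊗ A(x))` for all `ϱ`, `x`. -/
def Broadcasts (Λ : traceClass H →ₗ[ℂ] traceClass (HTensor H H)) (A : POVM Ω H) : Prop :=
  ∀ ϱ, IsState ϱ → ∀ x,
    A.prob ϱ x = opTrace ((Λ ϱ : HTensor H H →L[ℂ] HTensor H H) * tensorOp (A.op x) 1) ∧
    A.prob ϱ x = opTrace ((Λ ϱ : HTensor H H →L[ℂ] HTensor H H) * tensorOp 1 (A.op x))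

/-- `A` and `B` are broadcastable if one channel broadcasts both. -/
def Broadcastable (A : POVM Ω H) (B : POVM Ω' H) : Prop :=
  ∃ Λ : traceClass H →ₗ[ℂ] traceClass (HTensor H H),
    IsChannel Λ ∧ Broadcasts Λ A ∧ Broadcasts Λ B

/-- `A` and `B` are one-side broadcastable. -/
def OneSideBroadcastable (A : POVM Ω H) (B : POVM Ω' H) : Prop :=
  ∃ Λ : traceClass H →ₗ[ℂ] traceClass (HTensor H H), IsChannel Λ ∧ ∀ ϱ, IsState ϱ →
    (∀ x, A.prob ϱ x = opTrace ((Λ ϱ : HTensor H H →L[ℂ] HTensor H H) * tensorOp (A.op x) 1)) ∧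
    (∀ y, B.prob ϱ y = opTrace ((Λ ϱ : HTensor H H →L[ℂ] HTensor H H) * tensorOp 1 (B.op y)))

/-- The family `I` is an instrument implementing a measurement of `A`. -/
def IsInstrument (I : Ω → traceClass H →ₗ[ℂ] traceClass H) (A : POVM Ω H) : Prop :=
  (∀ x, IsCompletelyPositive (I x)) ∧
    ∀ ϱ, IsState ϱ → ∀ x, opTrace (I x ϱ : H →L[ℂ] H) = A.prob ϱ x

/-- `A` can be measured without disturbing `B`. -/
def MeasurableWithoutDisturbing (A : POVM Ω H) (B : POVM Ω' H) : Prop :=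
  ∃ I : Ω → traceClass H →ₗ[ℂ] traceClass H, IsInstrument I A ∧
    ∀ ϱ, IsState ϱ → ∀ y, B.prob ϱ y = B.prob (∑ x, I x ϱ) y

/-- `A` and `B` are mutually nondisturbing. -/
def MutuallyNondisturbing (A : POVM Ω H) (B : POVM Ω' H) : Prop :=
  MeasurableWithoutDisturbing A B ∧ MeasurableWithoutDisturbing B A

/-- `A` and `B` are nondisturbing. -/
def Nondisturbing (A : POVM Ω H) (B : POVM Ω' H) : Prop :=
  MeasurableWithoutDisturbing A B ∨ MeasurableWithoutDisturbing B A

end relations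

end QObs

end

noncomputable section

set_option linter.unusedSectionVars false

namespace QObs

open ContinuousLinearMap InnerProductSpace

variable {H K : Type*}
  [NormedAddCommGroup H] [InnerProductSpace ℂ H] [CompleteSpace H]
  [NormedAddCommGroup K] [InnerProductSpace ℂ K] [CompleteSpace K]
  {Ω Ω' : Type*} [Fintype Ω] [Fintype Ω']

/-! ### Hilbert–Schmidt operators -/

/-! Nondisturbance and one-side broadcasting both yield positive functionals `M x S` on trace class
operators, linear in `S`, with `M x 1 = tr(· A(x))` and `∑ x, M x S = tr(· S)` for `S` in the span
of the effects of `B`. If that span contains the projection `Q` onto a unit vector `φ`, then `M x Q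
≤ tr(· Q)` vanishes at `|η⟩⟨η|` for `η ⊥ φ`, and `M x (1 - Q) ≤ tr(· (1 - Q))` vanishes at `|φ⟩⟨φ|`.
By Cauchy–Schwarz both vanish at `|η⟩⟨φ|`; their sum there is `⟪φ, A(x) η⟫`, so this is zero
(`inner_op_eq_zero_of_joint`).

Informational completeness makes the statistics map injective on all trace class operators, and
duality puts every bounded operator in the span of the effects (`InformationallyComplete.mem_span`).
Were `A` related to itself, every unit vector would be an eigenvector of every effect; all effects
would be scalar and could not separate two orthogonal pure states.

Failure of reflexivity needs only one projection in the span, hence two rank one effects, so it also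
covers infinite dimension. Existence in finite dimension is polarization. The analytic groundwork
writes positive trace class operators as `R* R` with `R` Hilbert–Schmidt. -/

theorem summable_sq_norm_iff {ι : Type*} (u : ι → H) :
    Summable (fun i => ‖u i‖ ^ 2) ↔ ∑' i, ENNReal.ofReal (‖u i‖ ^ 2) ≠ ⊤ := by
  constructor
  · intro h
    rw [← ENNReal.ofReal_tsum_of_nonneg (fun _ => by positivity) h]
    exact ENNReal.ofReal_ne_top
  · intro h
    simpa [ENNReal.toReal_ofReal] using ENNReal.summable_toReal h

theorem summable_sq_adjoint {ι : Type*} (e : HilbertBasis ι ℂ H) {R : H →L[ℂ] H}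
    (h : Summable fun i => ‖R (e i)‖ ^ 2) : Summable fun i => ‖adjoint R (e i)‖ ^ 2 := by
  rw [summable_sq_norm_iff] at h ⊢
  rwa [← tsum_sq_norm_adjoint e e R]

theorem summable_sq_comp_left {ι : Type*} {e : ι → H} {R : H →L[ℂ] H}
    (h : Summable fun i => ‖R (e i)‖ ^ 2) (S : H →L[ℂ] H) :
    Summable fun i => ‖S (R (e i))‖ ^ 2 := by
  refine Summable.of_nonneg_of_le (fun _ => by positivity) (fun i => ?_) (h.mul_left (‖S‖ ^ 2))
  rw [← mul_pow]
  gcongr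
  exact S.le_opNorm _

/-- Since `(R S)* = S* R*`, taking adjoints reduces this to composition on the left. -/
theorem summable_sq_comp_right {ι : Type*} (e : HilbertBasis ι ℂ H) {R : H →L[ℂ] H}
    (h : Summable fun i => ‖R (e i)‖ ^ 2) (S : H →L[ℂ] H) :
    Summable fun i => ‖R (S (e i))‖ ^ 2 := by
  have h1 := summable_sq_comp_left (summable_sq_adjoint e h) (adjoint S)
  have h2 := summable_sq_adjoint (R := adjoint (R * S)) e (by
    convert h1 using 3
    rw [← mul_apply_eq_comp, ← star_eq_adjoint, star_mul]
    rfl)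
  simpa using h2

theorem summable_inner_of_sq {ι : Type*} {u v : ι → H} (hu : Summable fun i => ‖u i‖ ^ 2)
    (hv : Summable fun i => ‖v i‖ ^ 2) : Summable fun i => ⟪u i, v i⟫_ℂ := by
  refine Summable.of_norm_bounded (hu.add hv) fun i => (norm_inner_le_norm _ _).trans ?_
  nlinarith [sq_nonneg (‖u i‖ - ‖v i‖), sq_nonneg (‖u i‖ + ‖v i‖)]

theorem hasSum_sq_inner {ι : Type*} (e : HilbertBasis ι ℂ H) (x : H) :
    HasSum (fun j => ‖⟪e j, x⟫_ℂ‖ ^ 2) (‖x‖ ^ 2) := by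
  have h := Complex.hasSum_re (e.hasSum_inner_mul_inner x x)
  rw [inner_self_eq_norm_sq_to_K] at h
  convert! h using 1
  · ext i
    rw [← inner_conj_symm x (e i), RCLike.conj_mul]
    norm_cast
  · norm_cast

theorem summable_prod_sq_inner {ι : Type*} (e : HilbertBasis ι ℂ H) {R : H →L[ℂ] H}
    (h : Summable fun i => ‖R (e i)‖ ^ 2) :
    Summable fun p : ι × ι => ‖⟪e p.2, R (e p.1)⟫_ℂ‖ ^ 2 := by
  rw [summable_prod_of_nonneg (fun _ => by positivity)]
  refine ⟨fun i => (hasSum_sq_inner e (R (e i))).summable, ?_⟩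
  simpa only [(hasSum_sq_inner e _).tsum_eq] using h

/-- Cyclicity `tr(R* X) = tr(X R*)`: expand by Parseval and exchange the sums, which is legitimate
because the matrix entries of both operators are square summable. -/
theorem tsum_inner_adjoint {ι : Type*} (e : HilbertBasis ι ℂ H) {R X : H →L[ℂ] H}
    (hR : Summable fun i => ‖R (e i)‖ ^ 2) (hX : Summable fun i => ‖X (e i)‖ ^ 2) :
    ∑' i, ⟪R (e i), X (e i)⟫_ℂ = ∑' j, ⟪adjoint X (e j), adjoint R (e j)⟫_ℂ := by
  have hs : Summable fun p : ι × ι => ⟪R (e p.1), e p.2⟫_ℂ * ⟪e p.2, X (e p.1)⟫_ℂ := by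
    refine Summable.of_norm_bounded
      ((summable_prod_sq_inner e hR).add (summable_prod_sq_inner e hX)) fun p => ?_
    rw [norm_mul, norm_inner_symm]
    nlinarith [sq_nonneg (‖⟪e p.2, R (e p.1)⟫_ℂ‖ - ‖⟪e p.2, X (e p.1)⟫_ℂ‖),
      sq_nonneg (‖⟪e p.2, R (e p.1)⟫_ℂ‖ + ‖⟪e p.2, X (e p.1)⟫_ℂ‖)]
  calc ∑' i, ⟪R (e i), X (e i)⟫_ℂ
      = ∑' i, ∑' j, ⟪R (e i), e j⟫_ℂ * ⟪e j, X (e i)⟫_ℂ :=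
        tsum_congr fun i => (e.tsum_inner_mul_inner _ _).symm
    _ = ∑' j, ∑' i, ⟪R (e i), e j⟫_ℂ * ⟪e j, X (e i)⟫_ℂ := hs.prod_symm.tsum_comm
    _ = _ := tsum_congr fun j => by
        rw [← e.tsum_inner_mul_inner]
        refine tsum_congr fun i => ?_
        rw [adjoint_inner_left, adjoint_inner_right, mul_comm]

/-! ### Trace class operators -/

theorem IsPositive.exists_adjoint_mul {T : H →L[ℂ] H} (hT : T.IsPositive) :
    ∃ R : H →L[ℂ] H, ∀ x y, ⟪x, T y⟫_ℂ = ⟪R x, R y⟫_ℂ := by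
  obtain ⟨R, hR⟩ : ∃ R : H →L[ℂ] H, T = star R * R :=
    CStarAlgebra.nonneg_iff_eq_star_mul_self.mp ((nonneg_iff_isPositive T).mpr hT)
  refine ⟨R, fun x y => ?_⟩
  rw [hR, mul_apply_eq_comp, star_eq_adjoint, adjoint_inner_right]

theorem HasFiniteTrace.summable_sq {T R : H →L[ℂ] H} (hT : HasFiniteTrace T)
    (hR : ∀ x y, ⟪x, T y⟫_ℂ = ⟪R x, R y⟫_ℂ) : Summable fun i => ‖R (basis H i)‖ ^ 2 := by
  have h := hT
  simp only [HasFiniteTrace, hR, inner_self_eq_norm_sq_to_K] at h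
  exact_mod_cast h

/-- For `T = R* R` the terms are `⟪R eᵢ, R S eᵢ⟫`, with both `R` and `R S` Hilbert–Schmidt. -/
theorem summable_trace_mul {T : H →L[ℂ] H} (hT : T ∈ traceClass H) (S : H →L[ℂ] H) :
    Summable fun i => ⟪basis H i, (T * S) (basis H i)⟫_ℂ := by
  induction hT using Submodule.span_induction with
  | mem T h =>
    obtain ⟨R, hR⟩ := IsPositive.exists_adjoint_mul h.1
    have hs := h.2.summable_sq hR
    simp only [mul_apply_eq_comp, hR]
    exact summable_inner_of_sq hs (summable_sq_comp_right _ hs S)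
  | zero => simp
  | add T T' _ _ h h' => simpa [add_mul, inner_add_right] using h.add h'
  | smul c T _ h => simpa [inner_smul_right] using h.mul_left c

theorem hasFiniteTrace_of_mem {T : H →L[ℂ] H} (hT : T ∈ traceClass H) : HasFiniteTrace T := by
  simpa using! summable_trace_mul hT 1

/-- The functional `T ↦ tr (T S)` on the trace class operators. -/
def traceMul (S : H →L[ℂ] H) : traceClass H →ₗ[ℂ] ℂ where
  toFun T := opTrace ((T : H →L[ℂ] H) * S)
  map_add' T T' := by
    simp only [opTrace, Submodule.coe_add, add_mul, add_apply, inner_add_right]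
    exact (summable_trace_mul T.2 S).tsum_add (summable_trace_mul T'.2 S)
  map_smul' c T := by
    simp only [opTrace, Submodule.coe_smul, smul_mul_assoc, FunLike.coe_smul, Pi.smul_apply,
      inner_smul_right, RingHom.id_apply, smul_eq_mul]
    exact tsum_mul_left

theorem traceMul_apply (S : H →L[ℂ] H) (T : traceClass H) :
    traceMul S T = opTrace ((T : H →L[ℂ] H) * S) := rfl

theorem traceMul_one (T : traceClass H) : traceMul 1 T = opTrace (T : H →L[ℂ] H) := by
  rw [traceMul_apply, mul_one]

theorem traceMul_add (S S' : H →L[ℂ] H) : traceMul (S + S') = traceMul S + traceMul S' := by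
  ext T
  simp only [traceMul_apply, LinearMap.add_apply, opTrace, mul_add, add_apply, inner_add_right]
  exact (summable_trace_mul T.2 S).tsum_add (summable_trace_mul T.2 S')

theorem traceMul_smul (c : ℂ) (S : H →L[ℂ] H) : traceMul (c • S) = c • traceMul S := by
  ext T
  simp only [traceMul_apply, LinearMap.smul_apply, opTrace, mul_smul_comm, FunLike.coe_smul,
    Pi.smul_apply, inner_smul_right, smul_eq_mul]
  exact tsum_mul_left

/-- With `T = R* R` and `S = B* B`, cyclicity turns `tr(T S)` into `∑ⱼ ‖B R* eⱼ‖²`. -/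
theorem traceMul_nonneg {T : traceClass H} (hT : (T : H →L[ℂ] H).IsPositive) {S : H →L[ℂ] H}
    (hS : S.IsPositive) : 0 ≤ traceMul S T := by
  obtain ⟨R, hR⟩ := IsPositive.exists_adjoint_mul hT
  obtain ⟨B, hB⟩ := IsPositive.exists_adjoint_mul hS
  have hs := (hasFiniteTrace_of_mem T.2).summable_sq hR
  have h : traceMul S T =
      ∑' j, ⟪B (adjoint R (basis H j)), B (adjoint R (basis H j))⟫_ℂ := by
    rw [traceMul_apply, opTrace]
    refine (tsum_congr fun i => ?_).trans ((tsum_inner_adjoint (basis H) (X := R * S) hs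
      (summable_sq_comp_right _ hs S)).trans (tsum_congr fun j => ?_))
    · rw [mul_apply_eq_comp, hR, mul_apply_eq_comp]
    · rw [← hB, adjoint_inner_left, mul_apply_eq_comp, adjoint_inner_left]
  rw [h]
  exact tsum_nonneg fun j => (RCLike.ofReal_nonneg.mpr (sq_nonneg _)).trans_eq
    ((RCLike.ofReal_pow _ _).trans (inner_self_eq_norm_sq_to_K _).symm)

theorem eq_zero_of_opTrace_eq_zero {T : H →L[ℂ] H} (hT : T.IsPositive) (hf : HasFiniteTrace T)
    (h : opTrace T = 0) : T = 0 := by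
  obtain ⟨R, hR⟩ := IsPositive.exists_adjoint_mul hT
  have h1 : HasSum (fun i => ((‖R (basis H i)‖ ^ 2 : ℝ) : ℂ)) 0 := by
    rw [← h]
    convert! hf.hasSum using 2 with i
    rw [hR, inner_self_eq_norm_sq_to_K]
    norm_cast
  have h2 : HasSum (fun i => ‖R (basis H i)‖ ^ 2) 0 := by
    rwa [← Complex.ofReal_zero, Complex.hasSum_ofReal] at h1
  rw [hasSum_zero_iff_of_nonneg fun _ => by positivity] at h2
  have h3 : R = 0 := by
    refine ContinuousLinearMap.ext_on
      (s := Set.range (basis H)) ?_ ?_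
    · rw [dense_iff_closure_eq, ← Submodule.topologicalClosure_coe, (basis H).dense_span]
      rfl
    · rintro _ ⟨i, rfl⟩
      simpa using congrFun h2 i
  ext y
  refine ext_inner_left ℂ fun x => ?_
  simp [hR, h3]

theorem traceMul_one_eq_zero {T : traceClass H} (hT : (T : H →L[ℂ] H).IsPositive)
    (h : traceMul 1 T = 0) : T = 0 :=
  Subtype.ext (eq_zero_of_opTrace_eq_zero hT (hasFiniteTrace_of_mem T.2) (traceMul_one T ▸ h))

theorem isState_inv_smul {T : traceClass H} (hT : (T : H →L[ℂ] H).IsPositive)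
    (h : traceMul 1 T ≠ 0) : IsState ((traceMul 1 T)⁻¹ • T) := by
  refine ⟨hT.smul_of_nonneg (inv_nonneg.mpr (traceMul_nonneg hT isPositive_one)), ?_⟩
  rw [← traceMul_one, map_smul, smul_eq_mul, inv_mul_cancel₀ h]

theorem traceClass_induction {p : traceClass H → Prop}
    (pos : ∀ T : traceClass H, (T : H →L[ℂ] H).IsPositive → p T)
    (add : ∀ T T', p T → p T' → p (T + T')) (smul : ∀ (c : ℂ) T, p T → p (c • T))
    (T : traceClass H) : p T := by
  obtain ⟨T, hT⟩ := T
  induction hT using Submodule.span_induction with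
  | mem T h => exact pos _ h.1
  | zero => exact pos 0 isPositive_zero
  | add T T' h h' i i' => exact add ⟨T, h⟩ ⟨T', h'⟩ i i'
  | smul c T h i => exact smul c ⟨T, h⟩ i

/-- Positive trace class operators span, and each is zero or a multiple of a state. -/
theorem linearMap_ext_state {f g : traceClass H →ₗ[ℂ] ℂ} (h : ∀ ϱ, IsState ϱ → f ϱ = g ϱ) :
    f = g := by
  ext T
  induction T using traceClass_induction with
  | pos T hT =>
    by_cases h0 : traceMul 1 T = 0
    · rw [traceMul_one_eq_zero hT h0, map_zero, map_zero]
    · have := h _ (isState_inv_smul hT h0)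
      rw [map_smul, map_smul] at this
      exact smul_right_injective ℂ (inv_ne_zero h0) this
  | add T T' i i' => rw [map_add, map_add, i, i']
  | smul c T i => rw [map_smul, map_smul, i]

/-! ### Rank one operators -/

theorem hasSum_trace_rankOne (x y : H) (S : H →L[ℂ] H) :
    HasSum (fun i => ⟪basis H i, (rankOne ℂ x y * S) (basis H i)⟫_ℂ) ⟪y, S x⟫_ℂ := by
  have h := (basis H).hasSum_inner_mul_inner (adjoint S y) x
  rw [adjoint_inner_left] at h
  convert! h using 2 with i
  rw [mul_apply_eq_comp, rankOne_apply, inner_smul_right, adjoint_inner_left]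

theorem rankOne_self_mem (x : H) : rankOne ℂ x x ∈ traceClass H :=
  Submodule.subset_span ⟨isPositive_rankOne_self x,
    by simpa [HasFiniteTrace] using (hasSum_trace_rankOne x x 1).summable⟩

theorem rankOne_mem (x y : H) : rankOne ℂ x y ∈ traceClass H := by
  -- Polarization, because the trace class is defined as a span of positive operators.
  have h : rankOne ℂ x y = (1 / 4 : ℂ) • (rankOne ℂ (x + y) (x + y) - rankOne ℂ (x - y) (x - y)
      + Complex.I • rankOne ℂ (x + Complex.I • y) (x + Complex.I • y)
      - Complex.I • rankOne ℂ (x - Complex.I • y) (x - Complex.I • y)) := by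
    ext z
    simp only [map_add, map_sub, map_smul, map_smulₛₗ, add_apply, sub_apply, smul_apply,
      rankOne_apply, smul_add, smul_sub, smul_smul, Complex.conj_I]
    have := Complex.I_mul_I
    match_scalars <;> grind
  rw [h]
  exact Submodule.smul_mem _ _ (Submodule.sub_mem _ (Submodule.add_mem _ (Submodule.sub_mem _
    (rankOne_self_mem _) (rankOne_self_mem _)) (Submodule.smul_mem _ _ (rankOne_self_mem _)))
    (Submodule.smul_mem _ _ (rankOne_self_mem _)))

/-- The trace class operator `|x⟩⟨y|`. -/
def ketbra (x y : H) : traceClass H := ⟨InnerProductSpace.rankOne ℂ x y, rankOne_mem x y⟩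

theorem traceMul_ketbra (S : H →L[ℂ] H) (x y : H) : traceMul S (ketbra x y) = ⟪y, S x⟫_ℂ :=
  (hasSum_trace_rankOne x y S).tsum_eq

theorem ketbra_self_isPositive (x : H) : (ketbra x x : H →L[ℂ] H).IsPositive :=
  InnerProductSpace.isPositive_rankOne_self x

theorem isState_ketbra {x : H} (hx : ‖x‖ = 1) : IsState (ketbra x x) := by
  refine ⟨ketbra_self_isPositive x, ?_⟩
  rw [← traceMul_one, traceMul_ketbra, one_apply_eq_self, inner_self_eq_norm_sq_to_K, hx]
  simp

/-! ### Tensor products of operators -/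

theorem HTensor.ext_tmul {E : Type*} [NormedAddCommGroup E] [NormedSpace ℂ E]
    {F G : HTensor H K →L[ℂ] E}
    (h : ∀ x y, F ((x ⊗ₜ[ℂ] y : H ⊗[ℂ] K) : HTensor H K) =
      G ((x ⊗ₜ[ℂ] y : H ⊗[ℂ] K) : HTensor H K)) : F = G := by
  ext u
  induction u using UniformSpace.Completion.induction_on with
  | hp => exact isClosed_eq F.continuous G.continuous
  | ih u =>
    induction u using TensorProduct.induction_on with
    | zero => rw [UniformSpace.Completion.coe_zero, map_zero, map_zero]
    | tmul x y => exact h x y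
    | add u v hu hv => rw [UniformSpace.Completion.coe_add, map_add, map_add, hu, hv]

theorem tensorOp_mul (S S' : H →L[ℂ] H) (T T' : K →L[ℂ] K) :
    tensorOp S T * tensorOp S' T' = tensorOp (S * S') (T * T') :=
  HTensor.ext_tmul fun x y => by simp only [mul_apply_eq_comp, tensorOp_tmul]

theorem tensorOp_add_left (S S' : H →L[ℂ] H) (T : K →L[ℂ] K) :
    tensorOp (S + S') T = tensorOp S T + tensorOp S' T :=
  HTensor.ext_tmul fun x y => by
    simp only [add_apply, tensorOp_tmul, TensorProduct.add_tmul, UniformSpace.Completion.coe_add]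

theorem tensorOp_add_right (S : H →L[ℂ] H) (T T' : K →L[ℂ] K) :
    tensorOp S (T + T') = tensorOp S T + tensorOp S T' :=
  HTensor.ext_tmul fun x y => by
    simp only [add_apply, tensorOp_tmul, TensorProduct.tmul_add, UniformSpace.Completion.coe_add]

theorem tensorOp_smul_right (c : ℂ) (S : H →L[ℂ] H) (T : K →L[ℂ] K) :
    tensorOp S (c • T) = c • tensorOp S T :=
  HTensor.ext_tmul fun x y => by
    simp only [smul_apply, tensorOp_tmul, TensorProduct.tmul_smul,
      UniformSpace.Completion.coe_smul]

theorem adjoint_tensorOp (S : H →L[ℂ] H) (T : K →L[ℂ] K) :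
    adjoint (tensorOp S T) = tensorOp (adjoint S) (adjoint T) := by
  refine HTensor.ext_tmul fun x y => ?_
  -- Comparing the functionals these vectors represent allows the test vector to be an elementary
  -- tensor as well.
  have : innerSL ℂ (adjoint (tensorOp S T) ((x ⊗ₜ[ℂ] y : H ⊗[ℂ] K) : HTensor H K)) =
      innerSL ℂ (tensorOp (adjoint S) (adjoint T) ((x ⊗ₜ[ℂ] y : H ⊗[ℂ] K) : HTensor H K)) := by
    refine HTensor.ext_tmul fun x' y' => ?_
    rw [innerSL_apply_apply, innerSL_apply_apply, adjoint_inner_left, tensorOp_tmul, tensorOp_tmul,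
      UniformSpace.Completion.inner_coe, UniformSpace.Completion.inner_coe,
      TensorProduct.inner_tmul, TensorProduct.inner_tmul, adjoint_inner_left, adjoint_inner_left]
  exact ext_inner_right ℂ fun v => congrArg (fun F => F v) this

theorem tensorOp_isPositive {S : H →L[ℂ] H} {T : K →L[ℂ] K} (hS : S.IsPositive)
    (hT : T.IsPositive) : (tensorOp S T).IsPositive := by
  obtain ⟨B, rfl⟩ := CStarAlgebra.nonneg_iff_eq_star_mul_self.mp
    ((nonneg_iff_isPositive S).mpr hS)
  obtain ⟨C, rfl⟩ := CStarAlgebra.nonneg_iff_eq_star_mul_self.mp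
    ((nonneg_iff_isPositive T).mpr hT)
  rw [← tensorOp_mul, star_eq_adjoint, star_eq_adjoint, ← adjoint_tensorOp]
  exact isPositive_adjoint_comp_self _

/-! ### Joint measurement with a rank one effect -/

theorem ketbra_add_smul_self (x y : H) (c : ℂ) :
    ketbra (x + c • y) (x + c • y) = ketbra x x + c • ketbra y x + (starRingEnd ℂ c) • ketbra x y
      + (starRingEnd ℂ c * c) • ketbra y y := by
  refine Subtype.ext ?_
  simp only [ketbra, Submodule.coe_add, Submodule.coe_smul, map_add, map_smul, map_smulₛₗ,
    add_apply, smul_apply, smul_add, smul_smul]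
  abel

/-- Cauchy–Schwarz for positive functionals, in the degenerate case. -/
theorem map_ketbra_eq_zero {f : traceClass H →ₗ[ℂ] ℂ}
    (hf : ∀ T : traceClass H, (T : H →L[ℂ] H).IsPositive → 0 ≤ f T) {y : H}
    (hy : f (ketbra y y) = 0) (x : H) :
    f (ketbra y x) = 0 ∧ f (ketbra x y) = 0 := by
  -- Positivity at `x + c y`: the `|c|²` term drops out by `hy`, leaving an expression real-affine
  -- in `c`. A real affine function bounded below is constant.
  have key : ∀ c : ℂ,
      0 ≤ f (ketbra x x) + c * f (ketbra y x) + starRingEnd ℂ c * f (ketbra x y) := by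
    intro c
    have h := hf _ (ketbra_self_isPositive (x + c • y))
    simpa only [ketbra_add_smul_self, map_add, map_smul, smul_eq_mul, hy, mul_zero, add_zero]
      using h
  generalize f (ketbra x x) = a at key
  generalize f (ketbra y x) = z at key ⊢
  generalize f (ketbra x y) = w at key ⊢
  have hre : ∀ r s : ℝ, 0 ≤ a.re + r * (z.re + w.re) + s * (w.im - z.im) := by
    intro r s
    have h := (Complex.nonneg_iff.mp (key ⟨r, s⟩)).1
    simp only [Complex.add_re, Complex.mul_re, Complex.conj_re, Complex.conj_im] at h
    linarith
  have him : ∀ r s : ℝ, 0 = a.im + r * (z.im + w.im) + s * (z.re - w.re) := by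
    intro r s
    have h := (Complex.nonneg_iff.mp (key ⟨r, s⟩)).2
    simp only [Complex.add_im, Complex.mul_im, Complex.conj_re, Complex.conj_im] at h
    linarith
  have hlin : ∀ b : ℝ, (∀ r : ℝ, 0 ≤ a.re + r * b) → b = 0 := by
    intro b hb
    by_contra h0
    -- This `r` would give the value `-1`.
    have := hb (-(a.re + 1) / b)
    rw [div_mul_cancel₀ _ h0] at this
    linarith
  have h1 := hlin _ fun r => by simpa using hre r 0
  have h2 := hlin _ fun s => by simpa using hre 0 s
  have h3 := him 0 0
  have h4 := him 1 0
  have h5 := him 0 1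
  exact ⟨Complex.ext (by simp; linarith) (by simp; linarith),
    Complex.ext (by simp; linarith) (by simp; linarith)⟩

/-- The inner product is `tr(|η⟩⟨φ| E)`; `f` kills `|η⟩⟨φ|` because of `η`, and `h` because of `φ`.
-/
theorem inner_eq_zero_of_joint {f h : traceClass H →ₗ[ℂ] ℂ} {E : H →L[ℂ] H} {φ η : H}
    (hf : ∀ T : traceClass H, (T : H →L[ℂ] H).IsPositive → 0 ≤ f T)
    (hh : ∀ T : traceClass H, (T : H →L[ℂ] H).IsPositive → 0 ≤ h T)
    (hsum : ∀ T, f T + h T = traceMul E T)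
    (hη : f (ketbra η η) = 0) (hφ : h (ketbra φ φ) = 0) :
    ⟪φ, E η⟫_ℂ = 0 := by
  rw [← traceMul_ketbra, ← hsum, (map_ketbra_eq_zero hf hη φ).1, (map_ketbra_eq_zero hh hφ η).2,
    add_zero]

theorem one_sub_rankOne_isPositive {φ : H} (hφ : ‖φ‖ = 1) : (1 - rankOne ℂ φ φ).IsPositive :=
  (nonneg_iff_isPositive _).mp (isStarProjection_rankOne_self hφ).one_sub.nonneg

theorem IsCompletelyPositive.isPositive {Φ : traceClass H →ₗ[ℂ] traceClass K}
    (hΦ : IsCompletelyPositive Φ) {T : traceClass H} (hT : (T : H →L[ℂ] H).IsPositive) :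
    (Φ T : K →L[ℂ] K).IsPositive := by
  have h := hΦ 1 (fun _ _ => T) fun ψ => by simpa using hT.inner_nonneg_right (ψ 0)
  rw [isPositive_iff_complex]
  intro x
  have hx : 0 ≤ ⟪x, (Φ T : K →L[ℂ] K) x⟫_ℂ := by simpa using h fun _ => x
  obtain ⟨h1, h2⟩ := Complex.nonneg_iff.mp hx
  rw [← inner_conj_symm, Complex.conj_eq_iff_im.mpr h2.symm]
  exact ⟨Complex.ext rfl h2, h1⟩

theorem POVM.one_mem_span (B : POVM Ω H) : (1 : H →L[ℂ] H) ∈ Submodule.span ℂ (Set.range B.op) := by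
  rw [← B.sum_op]
  exact Submodule.sum_mem _ fun x _ => Submodule.subset_span ⟨x, rfl⟩

/-- If `A` has a joint measurement with `B` and the linear span of the effects of `B` contains the
projection onto `φ`, then `φ` is an eigenvector of all effects of `A`. -/
theorem inner_op_eq_zero_of_joint (A : POVM Ω H) (B : POVM Ω' H)
    (M : Ω → (H →L[ℂ] H) →ₗ[ℂ] traceClass H →ₗ[ℂ] ℂ)
    (hpos : ∀ x S, S.IsPositive → ∀ T : traceClass H, (T : H →L[ℂ] H).IsPositive → 0 ≤ M x S T)
    (hA : ∀ x ϱ, IsState ϱ → M x 1 ϱ = A.prob ϱ x)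
    (hB : ∀ y ϱ, IsState ϱ → ∑ x, M x (B.op y) ϱ = B.prob ϱ y)
    {φ : H} (hφ : ‖φ‖ = 1) (hmem : rankOne ℂ φ φ ∈ Submodule.span ℂ (Set.range B.op))
    (x : Ω) {η : H} (hη : ⟪φ, η⟫_ℂ = 0) : ⟪φ, A.op x η⟫_ℂ = 0 := by
  -- The `B`-marginal is prescribed on the effects only; linearity in `S` extends it to their span.
  have hspan : ∀ S ∈ Submodule.span ℂ (Set.range B.op), ∑ x, M x S = traceMul S := by
    intro S hS
    induction hS using Submodule.span_induction with
    | mem S h =>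
      obtain ⟨y, rfl⟩ := h
      refine linearMap_ext_state fun ϱ hϱ => ?_
      rw [LinearMap.sum_apply, hB y ϱ hϱ]
      rfl
    | zero =>
      have h := traceMul_smul 0 (0 : H →L[ℂ] H)
      simp only [zero_smul] at h
      simp [h]
    | add S S' _ _ h h' => simp_rw [map_add, traceMul_add, Finset.sum_add_distrib, h, h']
    | smul c S _ h => simp_rw [map_smul, traceMul_smul, ← Finset.smul_sum, h]
  have hle : ∀ S ∈ Submodule.span ℂ (Set.range B.op), S.IsPositive → ∀ T : traceClass H,
      (T : H →L[ℂ] H).IsPositive → M x S T ≤ traceMul S T := by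
    intro S hS hS' T hT
    rw [← hspan S hS, LinearMap.sum_apply]
    exact Finset.single_le_sum (f := fun x => M x S T) (fun y _ => hpos y S hS' T hT)
      (Finset.mem_univ x)
  have hQ : (rankOne ℂ φ φ).IsPositive := isPositive_rankOne_self φ
  have hQ' := one_sub_rankOne_isPositive hφ
  -- Split `tr(· A(x))` along `1 = Q + (1 - Q)`; `hle` bounds each part at the vector where it must
  -- vanish.
  refine inner_eq_zero_of_joint (hpos x _ hQ) (hpos x _ hQ') (fun T => ?_) ?_ ?_
  · rw [← LinearMap.add_apply, ← map_add, add_sub_cancel]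
    exact DFunLike.congr_fun (linearMap_ext_state fun ϱ hϱ => hA x ϱ hϱ) T
  · refine le_antisymm ((hle _ hmem hQ _ (ketbra_self_isPositive η)).trans_eq ?_)
      (hpos x _ hQ _ (ketbra_self_isPositive η))
    rw [traceMul_ketbra, rankOne_apply, hη, zero_smul, inner_zero_right]
  · refine le_antisymm ((hle _ (Submodule.sub_mem _ B.one_mem_span hmem) hQ' _
      (ketbra_self_isPositive φ)).trans_eq ?_) (hpos x _ hQ' _ (ketbra_self_isPositive φ))
    rw [traceMul_ketbra, sub_apply, rankOne_apply, inner_self_eq_norm_sq_to_K, hφ]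
    simp

theorem MeasurableWithoutDisturbing.inner_op_eq_zero {A : POVM Ω H} {B : POVM Ω' H}
    (h : MeasurableWithoutDisturbing A B) {φ : H} (hφ : ‖φ‖ = 1)
    (hmem : rankOne ℂ φ φ ∈ Submodule.span ℂ (Set.range B.op))
    (x : Ω) {η : H} (hη : ⟪φ, η⟫_ℂ = 0) : ⟪φ, A.op x η⟫_ℂ = 0 := by
  obtain ⟨I, ⟨hcp, hI⟩, hB⟩ := h
  -- Sequential measurement: outcome `x` of the instrument, followed by the effect `S`.
  let M : Ω → (H →L[ℂ] H) →ₗ[ℂ] traceClass H →ₗ[ℂ] ℂ := fun x =>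
    { toFun := fun S => traceMul S ∘ₗ I x
      map_add' := fun S S' => by rw [traceMul_add, LinearMap.add_comp]
      map_smul' := fun c S => by rw [traceMul_smul, LinearMap.smul_comp]; rfl }
  refine inner_op_eq_zero_of_joint A B M (fun x S hS T hT =>
    traceMul_nonneg ((hcp x).isPositive hT) hS) (fun x ϱ hϱ => ?_) (fun y ϱ hϱ => ?_) hφ hmem x hη
  · exact (traceMul_one _).trans (hI ϱ hϱ x)
  · rw [hB ϱ hϱ y]
    exact (map_sum (traceMul (B.op y)) _ _).symm

theorem OneSideBroadcastable.inner_op_eq_zero {A : POVM Ω H} {B : POVM Ω' H}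
    (h : OneSideBroadcastable A B) {φ : H} (hφ : ‖φ‖ = 1)
    (hmem : rankOne ℂ φ φ ∈ Submodule.span ℂ (Set.range B.op))
    (x : Ω) {η : H} (hη : ⟪φ, η⟫_ℂ = 0) : ⟪φ, A.op x η⟫_ℂ = 0 := by
  obtain ⟨Λ, ⟨hcp, -⟩, hΛ⟩ := h
  -- Measure `A` on the first output copy and `S` on the second.
  let M : Ω → (H →L[ℂ] H) →ₗ[ℂ] traceClass H →ₗ[ℂ] ℂ := fun x =>
    { toFun := fun S => traceMul (tensorOp (A.op x) S) ∘ₗ Λ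
      map_add' := fun S S' => by rw [tensorOp_add_right, traceMul_add, LinearMap.add_comp]
      map_smul' := fun c S => by rw [tensorOp_smul_right, traceMul_smul, LinearMap.smul_comp]; rfl }
  refine inner_op_eq_zero_of_joint A B M (fun x S hS T hT =>
    traceMul_nonneg (hcp.isPositive hT) (tensorOp_isPositive (A.isPositive x) hS))
    (fun x ϱ hϱ => ?_) (fun y ϱ hϱ => ?_) hφ hmem x hη
  · exact ((hΛ ϱ hϱ).1 x).symm
  · rw [(hΛ ϱ hϱ).2 y, ← A.sum_op]
    have hsum : ∀ s : Finset Ω, (∑ x ∈ s, traceMul (tensorOp (A.op x) (B.op y)) (Λ ϱ)) =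
        traceMul (tensorOp (∑ x ∈ s, A.op x) (B.op y)) (Λ ϱ) := by
      intro s
      induction s using Finset.cons_induction with
      | empty =>
        have h := traceMul_smul 0 (tensorOp (0 : H →L[ℂ] H) (B.op y))
        have h' : tensorOp (0 : H →L[ℂ] H) (B.op y) = 0 := by
          simpa using tensorOp_add_left (0 : H →L[ℂ] H) 0 (B.op y)
        rw [h', smul_zero, zero_smul] at h
        simp [h', h]
      | cons x s hx ih =>
        rw [Finset.sum_cons, Finset.sum_cons, tensorOp_add_left, traceMul_add,
          LinearMap.add_apply, ih]
    exact hsum Finset.univ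

theorem Broadcastable.oneSideBroadcastable {A : POVM Ω H} {B : POVM Ω' H}
    (h : Broadcastable A B) : OneSideBroadcastable A B :=
  let ⟨Λ, hΛ, hA, hB⟩ := h
  ⟨Λ, hΛ, fun ϱ hϱ => ⟨fun x => (hA ϱ hϱ x).1, fun y => (hB ϱ hϱ y).2⟩⟩

/-- `A` is in none of the four relations with itself if some projection onto a vector `φ` is in the
linear span of its effects, but `φ` is not an eigenvector of all of them. -/
theorem not_self_related {A : POVM Ω H} {φ η : H} (hφ : ‖φ‖ = 1)
    (hmem : rankOne ℂ φ φ ∈ Submodule.span ℂ (Set.range A.op)) (hη : ⟪φ, η⟫_ℂ = 0) {x : Ω}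
    (hx : ⟪φ, A.op x η⟫_ℂ ≠ 0) :
    ¬ MeasurableWithoutDisturbing A A ∧ ¬ Nondisturbing A A ∧ ¬ MutuallyNondisturbing A A ∧
      ¬ OneSideBroadcastable A A ∧ ¬ Broadcastable A A := by
  have h1 : ¬ MeasurableWithoutDisturbing A A := fun h => hx (h.inner_op_eq_zero hφ hmem x hη)
  have h2 : ¬ OneSideBroadcastable A A := fun h => hx (h.inner_op_eq_zero hφ hmem x hη)
  exact ⟨h1, fun h => h.elim h1 h1, fun h => h1 h.1, h2, fun h => h2 h.oneSideBroadcastable⟩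

/-! ### Informationally complete observables -/

/-- Differences of two positive trace class operators. -/
def IsPositiveDiff (T : traceClass H) : Prop :=
  ∃ P Q : traceClass H, (P : H →L[ℂ] H).IsPositive ∧ (Q : H →L[ℂ] H).IsPositive ∧ T = P - Q

theorem IsPositiveDiff.add {T T' : traceClass H} (h : IsPositiveDiff T) (h' : IsPositiveDiff T') :
    IsPositiveDiff (T + T') := by
  obtain ⟨P, Q, hP, hQ, rfl⟩ := h
  obtain ⟨P', Q', hP', hQ', rfl⟩ := h'
  exact ⟨P + P', Q + Q', hP.add hP', hQ.add hQ', by abel⟩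

theorem IsPositiveDiff.smul {T : traceClass H} (h : IsPositiveDiff T) (a : ℝ) :
    IsPositiveDiff ((a : ℂ) • T) := by
  obtain ⟨P, Q, hP, hQ, rfl⟩ := h
  rcases le_total 0 a with ha | ha
  · exact ⟨(a : ℂ) • P, (a : ℂ) • Q, hP.smul_of_nonneg (by exact_mod_cast ha),
      hQ.smul_of_nonneg (by exact_mod_cast ha), smul_sub _ _ _⟩
  · refine ⟨((-a : ℝ) : ℂ) • Q, ((-a : ℝ) : ℂ) • P,
      hQ.smul_of_nonneg (by exact_mod_cast neg_nonneg.mpr ha),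
      hP.smul_of_nonneg (by exact_mod_cast neg_nonneg.mpr ha), ?_⟩
    push_cast
    module

/-- A Cartesian decomposition inside the trace class. It carries informational completeness, which
concerns states, over to arbitrary elements. -/
theorem exists_isPositiveDiff (T : traceClass H) :
    ∃ D D' : traceClass H, IsPositiveDiff D ∧ IsPositiveDiff D' ∧ T = D + Complex.I • D' := by
  induction T using traceClass_induction with
  | pos T hT =>
    exact ⟨T, 0, ⟨T, 0, hT, isPositive_zero, by simp⟩,
      ⟨0, 0, isPositive_zero, isPositive_zero, by simp⟩, by simp⟩
  | add T T' i i' =>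
    obtain ⟨D, E, hD, hE, rfl⟩ := i
    obtain ⟨D', E', hD', hE', rfl⟩ := i'
    exact ⟨D + D', E + E', hD.add hD', hE.add hE', by module⟩
  | smul c T i =>
    obtain ⟨D, E, hD, hE, rfl⟩ := i
    refine ⟨(c.re : ℂ) • D + ((-c.im : ℝ) : ℂ) • E, (c.re : ℂ) • E + (c.im : ℂ) • D,
      (hD.smul _).add (hE.smul _), (hE.smul _).add (hD.smul _), ?_⟩
    conv_lhs => rw [← Complex.re_add_im c]
    push_cast
    have := Complex.I_mul_I
    match_scalars <;> grind

/-- The linear map sending a trace class operator to its outcome statistics. -/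
def POVM.statistics (A : POVM Ω H) : traceClass H →ₗ[ℂ] (Ω → ℂ) :=
  LinearMap.pi fun x => traceMul (A.op x)

theorem POVM.statistics_apply (A : POVM Ω H) (T : traceClass H) (x : Ω) :
    A.statistics T x = traceMul (A.op x) T := rfl

theorem traceMul_sum (s : Finset Ω) (S : Ω → H →L[ℂ] H) :
    traceMul (∑ x ∈ s, S x) = ∑ x ∈ s, traceMul (S x) :=
  map_sum (⟨⟨traceMul, traceMul_add⟩, traceMul_smul⟩ :
    (H →L[ℂ] H) →ₗ[ℂ] traceClass H →ₗ[ℂ] ℂ) S s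

theorem POVM.sum_statistics (A : POVM Ω H) (T : traceClass H) :
    ∑ x, A.statistics T x = traceMul 1 T := by
  rw [← A.sum_op, traceMul_sum, LinearMap.sum_apply]
  rfl

theorem IsPositiveDiff.im_statistics {T : traceClass H} (h : IsPositiveDiff T) (A : POVM Ω H)
    (x : Ω) : (A.statistics T x).im = 0 := by
  obtain ⟨P, Q, hP, hQ, rfl⟩ := h
  rw [POVM.statistics_apply, map_sub, Complex.sub_im,
    ← (Complex.nonneg_iff.mp (traceMul_nonneg hP (A.isPositive x))).2,
    ← (Complex.nonneg_iff.mp (traceMul_nonneg hQ (A.isPositive x))).2, sub_zero]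

/-- The effects sum to `1`, so equal statistics force equal traces, and both positive parts
normalize to states by the same factor. -/
theorem InformationallyComplete.eq_zero {A : POVM Ω H} (hA : InformationallyComplete A)
    {D : traceClass H} (hD : IsPositiveDiff D) (h : A.statistics D = 0) : D = 0 := by
  obtain ⟨P, Q, hP, hQ, rfl⟩ := hD
  rw [map_sub, sub_eq_zero] at h
  have htr : traceMul 1 P = traceMul 1 Q := by
    rw [← A.sum_statistics, ← A.sum_statistics, h]
  by_cases h0 : traceMul 1 P = 0
  · rw [traceMul_one_eq_zero hP h0, traceMul_one_eq_zero hQ (htr ▸ h0), sub_zero]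
  · have hs := hA _ _ (isState_inv_smul hP h0) (isState_inv_smul hQ (htr ▸ h0)) fun x => by
      change A.statistics _ x = A.statistics _ x
      rw [map_smul, map_smul, h, htr]
    rw [← htr] at hs
    rw [smul_right_injective _ (inv_ne_zero h0) hs, sub_self]

theorem InformationallyComplete.statistics_injective {A : POVM Ω H}
    (hA : InformationallyComplete A) : LinearMap.ker A.statistics = ⊥ := by
  rw [LinearMap.ker_eq_bot']
  intro T hT
  obtain ⟨D, E, hD, hE, rfl⟩ := exists_isPositiveDiff T
  have key : ∀ x, A.statistics D x = 0 ∧ A.statistics E x = 0 := by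
    intro x
    have h := congrFun hT x
    rw [map_add, map_smul, Pi.add_apply, Pi.smul_apply, smul_eq_mul, Pi.zero_apply] at h
    have h1 := congrArg Complex.re h
    have h2 := congrArg Complex.im h
    simp only [Complex.add_re, Complex.add_im, Complex.mul_re, Complex.mul_im, Complex.I_re,
      Complex.I_im, hD.im_statistics, hE.im_statistics, Complex.zero_re, Complex.zero_im] at h1 h2
    exact ⟨Complex.ext (by simpa using h1) (hD.im_statistics A x),
      Complex.ext (by simpa using h2) (hE.im_statistics A x)⟩
  rw [hA.eq_zero hD (funext fun x => (key x).1), hA.eq_zero hE (funext fun x => (key x).2),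
    smul_zero, add_zero]

/-- A left inverse `g` of the statistics map writes `tr(T S)` as a combination of the numbers `tr(T
A(x))`, with coefficients `tr(g(δₓ) S)`. Testing on `|u⟩⟨v|` gives the operator identity. -/
theorem InformationallyComplete.mem_span {A : POVM Ω H} (hA : InformationallyComplete A)
    (S : H →L[ℂ] H) : S ∈ Submodule.span ℂ (Set.range A.op) := by
  classical
  obtain ⟨g, hg⟩ := LinearMap.exists_leftInverse_of_injective _ hA.statistics_injective
  have hS : S = ∑ x, traceMul S (g (Pi.single x 1)) • A.op x := by
    ext u
    refine ext_inner_left ℂ fun v => ?_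
    rw [← traceMul_ketbra, ← traceMul_ketbra, traceMul_sum, LinearMap.sum_apply]
    conv_lhs => rw [← LinearMap.id_apply (R := ℂ) (ketbra u v), ← hg, LinearMap.comp_apply,
      pi_eq_sum_univ' (A.statistics (ketbra u v)), map_sum, map_sum]
    refine Finset.sum_congr rfl fun x _ => ?_
    rw [traceMul_smul, LinearMap.smul_apply, map_smul, map_smul, smul_eq_mul, smul_eq_mul,
      mul_comm, POVM.statistics_apply]
  rw [hS]
  exact Submodule.sum_mem _ fun x _ => Submodule.smul_mem _ _ (Submodule.subset_span ⟨x, rfl⟩)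

theorem exists_orthonormal_pair (h : 2 ≤ Module.rank ℂ H) :
    ∃ e f : H, ‖e‖ = 1 ∧ ‖f‖ = 1 ∧ ⟪e, f⟫_ℂ = 0 := by
  obtain ⟨v, hv⟩ := Module.le_rank_iff (n := 2).mp (by exact_mod_cast h)
  have ho := gramSchmidtNormed_orthonormal hv
  exact ⟨_, _, ho.1 0, ho.1 1, ho.2 (by decide)⟩

theorem InformationallyComplete.not_self_related {A : POVM Ω H} (hA : InformationallyComplete A)
    (h : 2 ≤ Module.rank ℂ H) :
    ¬ MeasurableWithoutDisturbing A A ∧ ¬ Nondisturbing A A ∧ ¬ MutuallyNondisturbing A A ∧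
      ¬ OneSideBroadcastable A A ∧ ¬ Broadcastable A A := by
  obtain ⟨e, f, he, hf, hef⟩ := exists_orthonormal_pair h
  have hfe : ⟪f, e⟫_ℂ = 0 := inner_eq_zero_symm.mp hef
  by_contra hcon
  have key : ∀ x φ η, ‖φ‖ = 1 → ⟪φ, η⟫_ℂ = 0 → ⟪φ, A.op x η⟫_ℂ = 0 := by
    intro x φ η hφ hη
    by_contra hx
    exact hcon (QObs.not_self_related hφ (hA.mem_span _) hη hx)
  -- Apply `key` to the orthogonal vectors `e + f` and `e - f`; the cross terms vanish by `key` for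
  -- `e` and `f`.
  have heq : ∀ x, ⟪e, A.op x e⟫_ℂ = ⟪f, A.op x f⟫_ℂ := by
    intro x
    have hn : e + f ≠ 0 := by
      intro h0
      have := congrArg (fun v => ⟪e, v⟫_ℂ) h0
      simp [hef, he] at this
    have h1 := key x ((‖e + f‖⁻¹ : ℂ) • (e + f)) (e - f) (norm_smul_inv_norm hn) (by
      simp [hef, hfe, he, hf])
    have h2 := key x e f he hef
    have h3 := key x f e hf hfe
    have h4 : (‖e + f‖⁻¹ : ℂ) * (⟪e, A.op x e⟫_ℂ - ⟪f, A.op x f⟫_ℂ) = 0 := by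
      simp only [inner_smul_left, map_inv₀, Complex.conj_ofReal, map_sub, inner_add_left,
        inner_sub_right, h2, h3] at h1
      linear_combination h1
    exact sub_eq_zero.mp ((mul_eq_zero.mp h4).resolve_left (by simpa using hn))
  have hs := hA _ _ (isState_ketbra he) (isState_ketbra hf) fun x => by
    change traceMul (A.op x) _ = traceMul (A.op x) _
    rw [traceMul_ketbra, traceMul_ketbra, heq]
  have h1 : traceMul (rankOne ℂ e e) (ketbra e e) = traceMul (rankOne ℂ e e) (ketbra f f) :=
    congrArg _ hs
  rw [traceMul_ketbra, traceMul_ketbra, rankOne_apply, rankOne_apply, hef] at h1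
  simp [he] at h1

/-! ### Trivial noise and self-compatibility -/

theorem POVM.prob_mix (A B : POVM Ω H) {c : ℝ} (h0 : 0 ≤ c) (h1 : c ≤ 1) (ϱ : traceClass H)
    (x : Ω) : (A.mix c h0 h1 B).prob ϱ x = c * A.prob ϱ x + (1 - c : ℝ) * B.prob ϱ x := by
  change traceMul (_ • _ + _ • _) ϱ = _
  rw [traceMul_add, traceMul_smul, traceMul_smul]
  rfl

theorem POVM.prob_trivial {t : Ω → ℝ} (ht : t ∈ stdSimplex ℝ Ω) {ϱ : traceClass H}
    (hϱ : IsState ϱ) (x : Ω) : (POVM.trivial t ht : POVM Ω H).prob ϱ x = t x := by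
  change traceMul (_ • _) ϱ = _
  rw [traceMul_smul, LinearMap.smul_apply, traceMul_one, hϱ.2, smul_eq_mul, mul_one]

/-- The noise adds a state-independent constant to each probability, and `c ≠ 0` can be cancelled.
-/
theorem InformationallyComplete.mix_trivial {A : POVM Ω H} (hA : InformationallyComplete A)
    {c : ℝ} (h0 : 0 < c) (h1 : c ≤ 1) {t : Ω → ℝ} (ht : t ∈ stdSimplex ℝ Ω) :
    InformationallyComplete (A.mix c h0.le h1 (POVM.trivial t ht)) := by
  intro ϱ σ hϱ hσ h
  refine hA ϱ σ hϱ hσ fun x => ?_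
  have := h x
  rw [POVM.prob_mix, POVM.prob_mix, POVM.prob_trivial ht hϱ, POVM.prob_trivial ht hσ,
    add_left_inj] at this
  exact mul_left_cancel₀ (Complex.ofReal_ne_zero.mpr h0.ne') this

theorem compatible_self (A : POVM Ω H) : Compatible A A := by
  classical
  -- Measure once and copy the outcome: the joint observable lives on the diagonal.
  refine ⟨⟨fun p => if p.1 = p.2 then A.op p.1 else 0, fun p => ?_, ?_⟩, fun x => ?_, fun y => ?_⟩
  · split_ifs
    · exact A.isPositive _
    · exact isPositive_zero
  · simp [Fintype.sum_prod_type, A.sum_op]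
  · simp
  · simp

/-! ### Observables built from vectors -/

theorem traceMul_rankOne (T : traceClass H) (v : H) :
    traceMul (rankOne ℂ v v) T = ⟪v, (T : H →L[ℂ] H) v⟫_ℂ := by
  have h := traceMul_ketbra 1 ((T : H →L[ℂ] H) v) v
  rw [one_apply_eq_self, traceMul_one] at h
  exact (congrArg opTrace (comp_rankOne _ _ _)).trans h

/-- Scale the projectors until their sum is at most `1`; the outcome `none` takes the remainder. The
`+ 1` in `c` covers the case `S = 0`. -/
theorem exists_povm_of_vectors {κ : Type*} [Fintype κ] (v : κ → H) :
    ∃ (A : POVM (Option κ) H) (c : ℝ), 0 < c ∧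
      ∀ k, A.op (some k) = (c : ℂ) • rankOne ℂ (v k) (v k) := by
  set S : H →L[ℂ] H := ∑ k, rankOne ℂ (v k) (v k) with hS
  set c : ℝ := (‖S‖ + 1)⁻¹ with hc
  have hc0 : 0 < c := by positivity
  have hSp : S.IsPositive := by
    rw [← nonneg_iff_isPositive]
    exact Finset.sum_nonneg fun k _ => (nonneg_iff_isPositive _).mpr (isPositive_rankOne_self _)
  refine ⟨⟨fun o => o.elim (1 - (c : ℂ) • S) fun k => (c : ℂ) • rankOne ℂ (v k) (v k), ?_, ?_⟩,
    c, hc0, fun k => rfl⟩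
  · rintro (_ | k)
    · have hSc : ((c : ℂ) • S).IsPositive := hSp.smul_of_nonneg (by exact_mod_cast hc0.le)
      have hn : ‖(c : ℂ) • S‖ ≤ 1 := by
        rw [norm_smul, Complex.norm_real, Real.norm_of_nonneg hc0.le, hc, inv_mul_le_one₀]
        · linarith
        · positivity
      change (1 - (c : ℂ) • S).IsPositive
      rw [← nonneg_iff_isPositive, sub_nonneg]
      exact (CStarAlgebra.norm_le_one_iff_of_nonneg _ ((nonneg_iff_isPositive _).mpr hSc)).mp hn
    · exact (isPositive_rankOne_self _).smul_of_nonneg (by exact_mod_cast hc0.le)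
  · rw [Fintype.sum_option]
    simp only [Option.elim_none, Option.elim_some]
    rw [← Finset.smul_sum, ← hS, sub_add_cancel]

theorem exists_observable_of_vectors {κ : Type*} [Fintype κ] (v : κ → H) :
    ∃ (A : Observable H) (c : ℝ), 0 < c ∧
      ∀ k, ∃ x, A.2.op x = (c : ℂ) • rankOne ℂ (v k) (v k) := by
  obtain ⟨A, c, hc, hA⟩ := exists_povm_of_vectors v
  let e : Option κ ≃ Finset.Ico (0 : ℤ) (Fintype.card (Option κ)) :=
    Fintype.equivOfCardEq (by simp)
  refine ⟨⟨_, ⟨fun x => A.op (e.symm x), fun x => A.isPositive _, ?_⟩⟩, c, hc, fun k =>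
    ⟨e (some k), ?_⟩⟩
  · rw [← A.sum_op]
    exact e.symm.sum_comp A.op
  · rw [← hA k]
    exact congrArg A.op (e.symm_apply_apply _)

/-- By polarization, the quadratic form of an operator at the vectors `bᵢ + iᵏ bⱼ` determines all
its matrix entries. -/
theorem exists_informationallyComplete [FiniteDimensional ℂ H] :
    ∃ A : Observable H, InformationallyComplete A.2 := by
  let b := stdOrthonormalBasis ℂ H
  obtain ⟨A, c, hc, hA⟩ := exists_observable_of_vectors
    fun p : Fin (Module.finrank ℂ H) × Fin (Module.finrank ℂ H) × Fin 4 =>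
      b p.1 + Complex.I ^ (p.2.2 : ℕ) • b p.2.1
  refine ⟨A, fun ϱ σ _ _ h => ?_⟩
  have hz : ∀ i j (k : Fin 4), ⟪((ϱ - σ : traceClass H) : H →L[ℂ] H)
      (b i + Complex.I ^ (k : ℕ) • b j), b i + Complex.I ^ (k : ℕ) • b j⟫_ℂ = 0 := by
    intro i j k
    obtain ⟨x, hx⟩ := hA (i, j, k)
    have h1 : traceMul (A.2.op x) (ϱ - σ) = 0 := by
      rw [map_sub, sub_eq_zero]
      exact h x
    rw [hx, traceMul_smul, LinearMap.smul_apply, traceMul_rankOne, smul_eq_zero,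
      inner_eq_zero_symm] at h1
    exact h1.resolve_left (Complex.ofReal_ne_zero.mpr hc.ne')
  rw [← sub_eq_zero]
  refine Subtype.ext ?_
  refine ContinuousLinearMap.coe_injective (b.toBasis.ext fun j => ?_)
  rw [OrthonormalBasis.coe_toBasis]
  refine InnerProductSpace.ext_inner_right_basis b.toBasis fun i => ?_
  rw [OrthonormalBasis.coe_toBasis, inner_map_polarization]
  have h0 := hz i j 0
  have h1 := hz i j 1
  have h2 := hz i j 2
  have h3 := hz i j 3
  have hI : Complex.I ^ 3 = -Complex.I := by rw [pow_succ, Complex.I_sq]; ring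
  simp only [Fin.val_zero, Fin.val_one, Fin.val_two, pow_zero, pow_one, one_smul, Complex.I_sq,
    show ((3 : Fin 4) : ℕ) = 3 from rfl, hI, neg_smul, ← sub_eq_add_neg] at h0 h1 h2 h3
  simp only [ContinuousLinearMap.coe_coe, h0, h1, h2, h3]
  simp

theorem exists_not_self_related (h : 2 ≤ Module.rank ℂ H) :
    ∃ A : Observable H, ¬ Nondisturbing A.2 A.2 ∧ ¬ MutuallyNondisturbing A.2 A.2 ∧
      ¬ OneSideBroadcastable A.2 A.2 ∧ ¬ Broadcastable A.2 A.2 := by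
  obtain ⟨e, f, he, hf, hef⟩ := exists_orthonormal_pair h
  -- The effect along `e` puts the projection onto `e` in the span; the one along `e + f` has
  -- off-diagonal entry `c ≠ 0` between `e` and `f`.
  obtain ⟨A, c, hc, hA⟩ := exists_observable_of_vectors fun b : Bool => cond b e (e + f)
  have hc' : (c : ℂ) ≠ 0 := Complex.ofReal_ne_zero.mpr hc.ne'
  obtain ⟨x, hx⟩ := hA true
  obtain ⟨y, hy⟩ := hA false
  refine ⟨A, (not_self_related (A := A.2) he ?_ hef (x := y) ?_).2⟩
  · rw [← inv_smul_smul₀ hc' (rankOne ℂ e e)]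
    exact Submodule.smul_mem _ _ (Submodule.subset_span ⟨x, hx⟩)
  · rw [hy]
    simp [hef, he, hf, hc.ne']

end QObs

end

theorem mainTheorem7 (H : Type*) [NormedAddCommGroup H] [InnerProductSpace ℂ H] [CompleteSpace H]
    [TopologicalSpace.SeparableSpace H] :
    -- every observable is compatible with itself
    (∀ (Ω : Type*) [Fintype Ω] (A : QObs.POVM Ω H), QObs.Compatible A A) ∧
    Std.Refl (fun A B : QObs.Observable H => QObs.Compatible A.2 B.2) ∧
    -- an informationally complete observable cannot be measured without disturbing itself,
    -- and is in none of the four stronger relations with itself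
    (2 ≤ Module.rank ℂ H →
      ∀ (Ω : Type*) [Fintype Ω] (A : QObs.POVM Ω H), QObs.InformationallyComplete A →
        ¬ QObs.MeasurableWithoutDisturbing A A ∧
        ¬ QObs.Nondisturbing A A ∧
        ¬ QObs.MutuallyNondisturbing A A ∧
        ¬ QObs.OneSideBroadcastable A A ∧
        ¬ QObs.Broadcastable A A) ∧
    -- informationally complete observables exist (with finitely many outcomes this requires
    -- a finite dimensional space)
    (FiniteDimensional ℂ H → ∃ A : QObs.Observable H, QObs.InformationallyComplete A.2) ∧
    -- none of the four stronger relations is reflexive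
    (2 ≤ Module.rank ℂ H →
      ¬ Std.Refl (fun A B : QObs.Observable H => QObs.Nondisturbing A.2 B.2) ∧
      ¬ Std.Refl (fun A B : QObs.Observable H => QObs.MutuallyNondisturbing A.2 B.2) ∧
      ¬ Std.Refl (fun A B : QObs.Observable H => QObs.OneSideBroadcastable A.2 B.2) ∧
      ¬ Std.Refl (fun A B : QObs.Observable H => QObs.Broadcastable A.2 B.2)) ∧
    -- mixing with trivial noise preserves informational completeness, hence self-disturbance
    (∀ (Ω : Type*) [Fintype Ω] (A : QObs.POVM Ω H), QObs.InformationallyComplete A →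
      ∀ (c : ℝ) (h0 : 0 < c) (h1 : c ≤ 1) (t : Ω → ℝ) (ht : t ∈ stdSimplex ℝ Ω),
        QObs.InformationallyComplete (A.mix c h0.le h1 (QObs.POVM.trivial t ht)) ∧
        (2 ≤ Module.rank ℂ H →
          ¬ QObs.MeasurableWithoutDisturbing (A.mix c h0.le h1 (QObs.POVM.trivial t ht))
            (A.mix c h0.le h1 (QObs.POVM.trivial t ht)))) := by
  refine ⟨fun Ω _ A => QObs.compatible_self A, ⟨fun A => QObs.compatible_self A.2⟩,
    fun h Ω _ A hA => hA.not_self_related h, fun h => QObs.exists_informationallyComplete,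
    fun h => ?_, fun Ω _ A hA c h0 h1 t ht => ⟨hA.mix_trivial h0 h1 ht,
      fun h => ((hA.mix_trivial h0 h1 ht).not_self_related h).1⟩⟩
  obtain ⟨A, h1, h2, h3, h4⟩ := QObs.exists_not_self_related h
  exact ⟨fun r => h1 (r.refl A), fun r => h2 (r.refl A), fun r => h3 (r.refl A),
    fun r => h4 (r.refl A)⟩
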